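/- A continuum is a compact connected metric space; subcontinua are nonempty. A continuum $X$ is hereditarily unicoherent if $A\cap B$ is connected (possibly empty) for every two subcontinua $A,B\subseteq X$. For $x\in X$ the meager composant of $x$ in $X$ is $$M_x=\bigcup\{L\subseteq X : L \text{ is a subcontinuum of } X,\ L \text{ is nowhere dense in } X,\ x\in L\},$$ and a set $M\subseteq X$ is a meager composant of $X$ if $M=M_x$ for some $x\in X$. A continuum is decomposable if it is the union of two of its proper subcontinua, and indecomposable otherwise. Theorem. Let $X$ be a hereditarily unicoherent continuum with more than one point. Then every meager composant of $X$ is closed in $X$ if and only if every indecomposable subcontinuum of $X$ is nowhere dense in $X$. -/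

import Mathlib

/-- A subcontinuum of a metric space: a nonempty compact connected subset. -/
def IsSubcontinuum {X : Type*} [TopologicalSpace X] (K : Set X) : Prop :=
  IsCompact K ∧ IsConnected K

/-- A space is hereditarily unicoherent if the intersection of any two subcontinua is connected
(the empty set counts as connected here). -/
def HereditarilyUnicoherent (X : Type*) [TopologicalSpace X] : Prop :=
  ∀ A B : Set X, IsSubcontinuum A → IsSubcontinuum B → IsPreconnected (A ∩ B)

/-- The meager composant of `x`: the union of all subcontinua of `X` that contain `x` and are
nowhere dense in `X`. -/
def meagerComposant {X : Type*} [TopologicalSpace X] (x : X) : Set X :=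
  ⋃₀ {L : Set X | IsSubcontinuum L ∧ IsNowhereDense L ∧ x ∈ L}

/-- `M` is a meager composant of `X` if it is the meager composant of some point. -/
def IsMeagerComposant {X : Type*} [TopologicalSpace X] (M : Set X) : Prop :=
  ∃ x : X, M = meagerComposant x

/-- `K` is the union of two proper subcontinua of itself. -/
def IsDecomposable {X : Type*} [TopologicalSpace X] (K : Set X) : Prop :=
  ∃ A B : Set X, IsSubcontinuum A ∧ IsSubcontinuum B ∧ A ⊂ K ∧ B ⊂ K ∧ A ∪ B = K

/-- An indecomposable subcontinuum of `X`: a subcontinuum that is not decomposable. -/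
def IsIndecomposableSubcontinuum {X : Type*} [TopologicalSpace X] (K : Set X) : Prop :=
  IsSubcontinuum K ∧ ¬ IsDecomposable K

open Set Topology

section General

variable {X : Type*} [TopologicalSpace X]

/-! Proper subcontinua of an indecomposable continuum `K` are nowhere dense. If `M_x` is closed for
some `x ∈ K`, boundary bumping then gives `K ⊆ M_x`. If `K` also had interior, unicoherence would
cover that interior by the components of `x` in `K \ B`, with `B` basic open sets meeting `K`. These
are countably many proper subcontinua, contradicting Baire.

Conversely, let `y` lie in the closure of `M = M_x` but not in `M`. The least continuum containing
`x` and `y` has nonempty interior `W`, and every continuum through `y` meeting `M` contains `W`,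
because nowhere dense pieces of `M` cannot help to cover `W`. The least continuum `C ⊇ W` inherits
this at some `z ∈ C`: every continuum through `z` meeting `M` contains `C`. As `M` is dense in `C`,
this makes `C` indecomposable, yet `C` has interior. -/

theorem IsSubcontinuum.union {A B : Set X} (hA : IsSubcontinuum A) (hB : IsSubcontinuum B)
    (h : (A ∩ B).Nonempty) : IsSubcontinuum (A ∪ B) :=
  ⟨hA.1.union hB.1, hA.2.union h hB.2⟩

theorem IsNowhereDense.union_of_isClosed {A B : Set X} (hA : IsNowhereDense A)
    (hB : IsNowhereDense B) (hAc : IsClosed A) (hBc : IsClosed B) : IsNowhereDense (A ∪ B) := by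
  rw [(hAc.union hBc).isNowhereDense_iff,
    interior_union_isClosed_of_interior_empty hAc (hBc.isNowhereDense_iff.1 hB)]
  exact hAc.isNowhereDense_iff.1 hA

theorem isNowhereDense_singleton [T1Space X] [ConnectedSpace X] [Nontrivial X] (x : X) :
    IsNowhereDense {x} := by
  rw [isClosed_singleton.isNowhereDense_iff]
  exact interior_singleton x

/-- Gluing along `x` keeps continua nowhere dense; with symmetry, the base point of a meager
composant can be moved freely within it. -/
theorem meagerComposant_subset [T2Space X] {x y : X} (h : y ∈ meagerComposant x) :
    meagerComposant x ⊆ meagerComposant y := by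
  obtain ⟨L, ⟨hL, hLn, hxL⟩, hyL⟩ := h
  rintro z ⟨N, ⟨hN, hNn, hxN⟩, hzN⟩
  exact ⟨L ∪ N, ⟨hL.union hN ⟨x, hxL, hxN⟩,
    hLn.union_of_isClosed hNn hL.1.isClosed hN.1.isClosed, Or.inl hyL⟩, Or.inr hzN⟩

theorem mem_meagerComposant_symm {x y : X} (h : y ∈ meagerComposant x) :
    x ∈ meagerComposant y := by
  obtain ⟨L, ⟨hL, hLn, hxL⟩, hyL⟩ := h
  exact ⟨L, ⟨hL, hLn, hyL⟩, hxL⟩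

theorem mem_meagerComposant_self [T1Space X] [ConnectedSpace X] [Nontrivial X] (x : X) :
    x ∈ meagerComposant x :=
  ⟨{x}, ⟨⟨isCompact_singleton, isConnected_singleton⟩, isNowhereDense_singleton x, rfl⟩, rfl⟩

theorem isSubcontinuum_closure_meagerComposant [T2Space X] [CompactSpace X] [ConnectedSpace X]
    [Nontrivial X] (x : X) : IsSubcontinuum (closure (meagerComposant x)) := by
  refine ⟨isClosed_closure.isCompact, IsConnected.closure ⟨⟨x, mem_meagerComposant_self x⟩, ?_⟩⟩
  exact isPreconnected_sUnion x _ (fun L hL => hL.2.2) (fun L hL => hL.1.2.isPreconnected)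

/-! ### Least subcontinua and boundary bumping -/

/-- The intersection of a downward directed family of subcontinua is a subcontinuum. -/
theorem isSubcontinuum_sInter_of_directedOn [T2Space X] [CompactSpace X] {S : Set (Set X)}
    (hne : S.Nonempty) (hd : DirectedOn (· ⊇ ·) S) (hS : ∀ s ∈ S, IsSubcontinuum s) :
    IsSubcontinuum (⋂₀ S) := by
  have hcl : IsClosed (⋂₀ S) := isClosed_sInter fun s hs => (hS s hs).1.isClosed
  have : Nonempty S := hne.to_subtype
  have hd' : Directed (· ⊇ ·) (fun s : S => (s : Set X)) := directedOn_iff_directed.1 hd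
  refine ⟨hcl.isCompact, ?_, ?_⟩
  · rw [sInter_eq_iInter]
    exact IsCompact.nonempty_iInter_of_directed_nonempty_isCompact_isClosed _ hd'
      (fun s => (hS s s.2).2.nonempty) (fun s => (hS s s.2).1) (fun s => (hS s s.2).1.isClosed)
  · rw [isPreconnected_iff_subset_of_fully_disjoint_closed hcl]
    intro u v hu hv huv hdisj
    obtain ⟨U, V, hU, hV, huU, hvV, hUV⟩ := normal_separation hu hv hdisj
    obtain ⟨s, hs⟩ := exists_subset_nhds_of_isCompact hd' (fun s => (hS s s.2).1)
      (U := U ∪ V) (fun x hx => (hU.union hV).mem_nhds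
        ((huv.trans (union_subset_union huU hvV)) (by rwa [sInter_eq_iInter])))
    have hsub : ⋂₀ S ⊆ s := sInter_subset_of_mem s.2
    rcases (hS s s.2).2.isPreconnected.subset_or_subset hU hV hUV hs with h | h
    · left
      intro x hx
      refine (huv hx).resolve_right fun hxv => ?_
      exact disjoint_left.1 hUV (h (hsub hx)) (hvV hxv)
    · right
      intro x hx
      refine (huv hx).resolve_left fun hxu => ?_
      exact disjoint_left.1 hUV (huU hxu) (h (hsub hx))

/-- In a hereditarily unicoherent continuum every nonempty set is contained in a least
subcontinuum. -/
theorem HereditarilyUnicoherent.exists_least_subcontinuum [T2Space X] [CompactSpace X]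
    [ConnectedSpace X] (hX : HereditarilyUnicoherent X) {A : Set X} (hA : A.Nonempty) :
    ∃ C, IsSubcontinuum C ∧ A ⊆ C ∧ ∀ D, IsSubcontinuum D → A ⊆ D → C ⊆ D := by
  refine ⟨⋂₀ {D | IsSubcontinuum D ∧ A ⊆ D}, ?_, subset_sInter fun D hD => hD.2,
    fun D hD hAD => sInter_subset_of_mem ⟨hD, hAD⟩⟩
  refine isSubcontinuum_sInter_of_directedOn
    ⟨univ, ⟨isCompact_univ, isConnected_univ⟩, subset_univ A⟩ ?_ fun s hs => hs.1
  rintro D ⟨hD, hAD⟩ E ⟨hE, hAE⟩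
  exact ⟨D ∩ E, ⟨⟨hD.1.inter hE.1, hA.mono (subset_inter hAD hAE), hX D E hD hE⟩,
    subset_inter hAD hAE⟩, inter_subset_left, inter_subset_right⟩

/-- Boundary bumping: the closure of a component of the complement of a closed set `C` meets
`C`. -/
theorem closure_connectedComponentIn_compl_inter_nonempty [T2Space X] [CompactSpace X]
    [ConnectedSpace X] {C : Set X} (hC : IsClosed C) (hne : C.Nonempty) {y : X} (hy : y ∉ C) :
    (closure (connectedComponentIn Cᶜ y) ∩ C).Nonempty := by
  by_contra hcon
  have hdisj : closure (connectedComponentIn Cᶜ y) ⊆ Cᶜ := fun z hz hzC => hcon ⟨z, hz, hzC⟩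
  obtain ⟨V, hV, hQV, hVC⟩ := normal_exists_closure_subset isClosed_closure hC.isOpen_compl hdisj
  have hyV : y ∈ closure V :=
    subset_closure (hQV (subset_closure (mem_connectedComponentIn hy)))
  let Z := closure V
  have : CompactSpace Z := isCompact_iff_compactSpace.1 isClosed_closure.isCompact
  let y' : Z := ⟨y, hyV⟩
  have hcomp : connectedComponent y' ⊆ ((↑) : Z → X) ⁻¹' V := by
    rw [← image_subset_iff]
    refine Subset.trans ?_ (subset_closure.trans hQV)
    refine IsPreconnected.subset_connectedComponentIn
      (isPreconnected_connectedComponent.image _ continuous_subtype_val.continuousOn)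
      ⟨y', mem_connectedComponent, rfl⟩ ?_
    rintro _ ⟨z, -, rfl⟩
    exact hVC z.2
  rw [connectedComponent_eq_iInter_isClopen] at hcomp
  have : Nonempty { s : Set Z // IsClopen s ∧ y' ∈ s } := ⟨⟨univ, isClopen_univ, mem_univ _⟩⟩
  -- Components of the compact space `Z` are intersections of clopen sets, so one clopen `N` already
  -- lies in `V`. Being clopen in `closure V` and inside the open set `V`, it is clopen in `X`,
  -- against connectedness.
  obtain ⟨⟨N, hN, hyN⟩, hNV⟩ := exists_subset_nhds_of_isCompact
    (V := fun s : { s : Set Z // IsClopen s ∧ y' ∈ s } => (s : Set Z))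
    (fun s t => ⟨⟨s ∩ t, s.2.1.inter t.2.1, s.2.2, t.2.2⟩, inter_subset_left, inter_subset_right⟩)
    (fun s => s.2.1.1.isCompact)
    (fun z hz => (hV.preimage continuous_subtype_val).mem_nhds (hcomp hz))
  have hclopen : IsClopen (((↑) : Z → X) '' N) := by
    refine ⟨(hN.1.isCompact.image continuous_subtype_val).isClosed, ?_⟩
    obtain ⟨O, hO, rfl⟩ := isOpen_induced_iff.1 hN.2
    have : ((↑) : Z → X) '' (((↑) : Z → X) ⁻¹' O) = O ∩ V := by
      ext z
      constructor
      · rintro ⟨w, hw, rfl⟩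
        exact ⟨hw, hNV hw⟩
      · rintro ⟨hz, hzV⟩
        exact ⟨⟨z, subset_closure hzV⟩, hz, rfl⟩
    rw [this]
    exact hO.inter hV
  obtain ⟨c, hc⟩ := hne
  have huniv := hclopen.eq_univ ⟨y, y', hyN, rfl⟩
  obtain ⟨w, -, hw⟩ : c ∈ ((↑) : Z → X) '' N := huniv ▸ mem_univ c
  exact hVC (hw ▸ w.2) hc

/-- Boundary bumping inside a subcontinuum. -/
theorem IsSubcontinuum.exists_subcontinuum_inter_nonempty [T2Space X] {K C : Set X}
    (hK : IsSubcontinuum K) (hC : IsClosed C) (hne : (K ∩ C).Nonempty) {y : X} (hyK : y ∈ K)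
    (hy : y ∉ C) :
    ∃ T, IsSubcontinuum T ∧ T ⊆ K ∧ y ∈ T ∧ (T ∩ C).Nonempty ∧ T ⊆ closure (K \ C) := by
  have : CompactSpace K := isCompact_iff_compactSpace.1 hK.1
  have : ConnectedSpace K := isConnected_iff_connectedSpace.1 hK.2
  let C' : Set K := ((↑) : K → X) ⁻¹' C
  have hyC' : (⟨y, hyK⟩ : K) ∈ C'ᶜ := hy
  obtain ⟨z, hz, hzC⟩ := closure_connectedComponentIn_compl_inter_nonempty (C := C')
    (hC.preimage continuous_subtype_val)
    (hne.elim fun c hc => ⟨⟨c, hc.1⟩, hc.2⟩) (y := ⟨y, hyK⟩) hyC'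
  refine ⟨((↑) : K → X) '' closure (connectedComponentIn C'ᶜ ⟨y, hyK⟩), ⟨?_, ?_⟩, ?_, ?_, ?_, ?_⟩
  · exact isClosed_closure.isCompact.image continuous_subtype_val
  · exact ((isConnected_connectedComponentIn_iff.2 hyC').closure).image _
      continuous_subtype_val.continuousOn
  · rintro _ ⟨w, -, rfl⟩
    exact w.2
  · exact ⟨_, subset_closure (mem_connectedComponentIn hyC'), rfl⟩
  · exact ⟨z, ⟨z, hz, rfl⟩, hzC⟩
  · refine (image_closure_subset_closure_image continuous_subtype_val).trans (closure_mono ?_)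
    rintro _ ⟨w, hw, rfl⟩
    exact ⟨w.2, connectedComponentIn_subset _ _ hw⟩

/-! ### Indecomposable subcontinua -/

/-- Adding to `L` one side `P` of a separation of `closure (K \ L)` gives a subcontinuum. -/
theorem IsSubcontinuum.union_of_separation [T2Space X] {K L P Q : Set X}
    (hK : IsSubcontinuum K) (hL : IsSubcontinuum L) (hP : IsCompact P) (hQ : IsClosed Q)
    (hPQ : Disjoint P Q) (hcov : L ∪ P ∪ Q = K) : IsSubcontinuum (L ∪ P) := by
  have hLP := hL.1.union hP
  refine ⟨hLP, hL.2.nonempty.mono subset_union_left, ?_⟩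
  rw [isPreconnected_iff_subset_of_fully_disjoint_closed hLP.isClosed]
  have key : ∀ u v : Set X, IsClosed u → IsClosed v → L ∪ P ⊆ u ∪ v → Disjoint u v → L ⊆ u →
      L ∪ P ⊆ u := by
    intro u v hu hv huv hdisj hLu
    have hvP : (L ∪ P) ∩ v ⊆ P := by
      rintro z ⟨hz | hz, hzv⟩
      · exact absurd hzv (disjoint_left.1 hdisj (hLu hz))
      · exact hz
    -- The part in `v` avoids `L`, so it lies in `P`, away from `Q`; it would split off from all of
    -- `K`.
    have hd : Disjoint ((L ∪ P) ∩ u ∪ Q) ((L ∪ P) ∩ v) :=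
      Disjoint.union_left (hdisj.mono inter_subset_right inter_subset_right)
        (hPQ.symm.mono_right hvP)
    have hsub : K ⊆ ((L ∪ P) ∩ u ∪ Q) ∪ ((L ∪ P) ∩ v) := by
      rw [← hcov]
      rintro z (hz | hz)
      · rcases huv hz with h | h
        · exact Or.inl (Or.inl ⟨hz, h⟩)
        · exact Or.inr ⟨hz, h⟩
      · exact Or.inl (Or.inr hz)
    have hLK : L ∪ P ⊆ K := hcov ▸ subset_union_left
    rcases (isPreconnected_iff_subset_of_fully_disjoint_closed hK.1.isClosed).1
      hK.2.isPreconnected _ _ ((hLP.isClosed.inter hu).union hQ) (hLP.isClosed.inter hv) hsub hd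
      with h | h
    · intro z hz
      refine (huv hz).resolve_right fun hzv => ?_
      exact disjoint_left.1 hd (h (hLK hz)) ⟨hz, hzv⟩
    · obtain ⟨l, hl⟩ := hL.2.nonempty
      exact absurd (h (hLK (Or.inl hl))).2 (disjoint_left.1 hdisj (hLu hl))
  intro u v hu hv huv hdisj
  rcases (isPreconnected_iff_subset_of_fully_disjoint_closed hL.1.isClosed).1
    hL.2.isPreconnected u v hu hv (subset_union_left.trans huv) hdisj with h | h
  · exact Or.inl (key u v hu hv huv hdisj h)
  · exact Or.inr (key v u hv hu (union_comm u v ▸ huv) hdisj.symm h)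

/-- A proper subcontinuum of an indecomposable subcontinuum is nowhere dense. -/
theorem IsIndecomposableSubcontinuum.isNowhereDense_of_ssubset [T2Space X] {K L : Set X}
    (hK : IsIndecomposableSubcontinuum K) (hL : IsSubcontinuum L) (hLK : L ⊂ K) :
    IsNowhereDense L := by
  rw [hL.1.isClosed.isNowhereDense_iff]
  by_contra hne
  obtain ⟨g, hg⟩ := nonempty_iff_ne_empty.2 hne
  set S := closure (K \ L) with hSdef
  have hSK : S ⊆ K := closure_minimal sdiff_subset hK.1.1.isClosed
  have hScomp : IsCompact S := hK.1.1.of_isClosed_subset isClosed_closure hSK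
  have hLS : L ∪ S = K := by
    refine subset_antisymm (union_subset hLK.1 hSK) fun z hz => ?_
    by_cases h : z ∈ L
    · exact Or.inl h
    · exact Or.inr (subset_closure ⟨hz, h⟩)
  have hgS : g ∉ S := by
    intro h
    obtain ⟨w, hw, hw'⟩ := mem_closure_iff.1 h _ isOpen_interior hg
    exact hw'.2 (interior_subset hw)
  obtain ⟨p, hpK, hpL⟩ := exists_of_ssubset hLK
  by_cases hconn : IsPreconnected S
  · exact hK.2 ⟨L, S, hL, ⟨hScomp, ⟨p, subset_closure ⟨hpK, hpL⟩⟩, hconn⟩, hLK,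
      ⟨hSK, fun h => hgS (h (hLK.1 (interior_subset hg)))⟩, hLS⟩
  rw [isPreconnected_iff_subset_of_fully_disjoint_closed isClosed_closure] at hconn
  push Not at hconn
  obtain ⟨u, v, hu, hv, huv, hdisj, hSu, hSv⟩ := hconn
  -- If `L` with one half of `S` were all of `K`, that half would contain `K \ L`, hence its closure
  -- `S`.
  have hproper : ∀ u v : Set X, IsClosed u → Disjoint u v → ¬ S ⊆ u → S ⊆ u ∪ v →
      L ∪ S ∩ u ⊂ K := by
    intro u v hu hdisj hSu huv
    refine ⟨union_subset hLK.1 (inter_subset_left.trans hSK), fun hsub => hSu ?_⟩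
    refine closure_minimal (fun z hz => ?_) hu
    exact ((hsub hz.1).resolve_left hz.2).2
  have hcov : L ∪ S ∩ u ∪ S ∩ v = K := by
    rw [union_assoc, ← inter_union_distrib_left, inter_eq_left.2 huv, hLS]
  have hcov' : L ∪ S ∩ v ∪ S ∩ u = K := by
    rw [← hcov, union_right_comm]
  have hd : Disjoint (S ∩ u) (S ∩ v) := hdisj.mono inter_subset_right inter_subset_right
  refine hK.2 ⟨L ∪ S ∩ u, L ∪ S ∩ v, ?_, ?_, hproper u v hu hdisj hSu huv,
    hproper v u hv hdisj.symm hSv (union_comm u v ▸ huv), ?_⟩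
  · exact hK.1.union_of_separation hL (hScomp.inter_right hu) (isClosed_closure.inter hv) hd hcov
  · exact hK.1.union_of_separation hL (hScomp.inter_right hv) (isClosed_closure.inter hu) hd.symm
      hcov'
  · rw [← union_union_distrib_left, ← union_assoc, hcov]

/-- An indecomposable subcontinuum contained in a meager composant of one of its points is nowhere
dense. -/
theorem IsIndecomposableSubcontinuum.isNowhereDense_of_subset_meagerComposant [T2Space X]
    [CompactSpace X] [SecondCountableTopology X] (hX : HereditarilyUnicoherent X) {K : Set X}
    (hK : IsIndecomposableSubcontinuum K) {x : X} (hx : x ∈ K) (hKx : K ⊆ meagerComposant x) :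
    IsNowhereDense K := by
  rw [hK.1.1.isClosed.isNowhereDense_iff]
  by_contra hne
  have hcount := TopologicalSpace.countable_countableBasis X
  let J := {B ∈ TopologicalSpace.countableBasis X | (B ∩ K).Nonempty}
  have hJ : J.Countable := hcount.mono (sep_subset _ _)
  have hmeagre : IsMeagre (⋃ B ∈ J, connectedComponentIn (K \ B) x) := by
    refine isMeagre_biUnion hJ fun B hB => IsNowhereDense.isMeagre ?_
    by_cases hxB : x ∈ K \ B
    · have hcomp : IsCompact (K \ B) :=
        hK.1.1.diff (TopologicalSpace.isOpen_of_mem_countableBasis hB.1)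
      refine hK.isNowhereDense_of_ssubset ⟨?_, isConnected_connectedComponentIn_iff.2 hxB⟩
        ⟨(connectedComponentIn_subset _ _).trans sdiff_subset, fun h => ?_⟩
      · refine hcomp.of_isClosed_subset (isClosed_of_closure_subset ?_)
          (connectedComponentIn_subset _ _)
        exact isPreconnected_connectedComponentIn.closure.subset_connectedComponentIn
          (subset_closure (mem_connectedComponentIn hxB))
          (closure_minimal (connectedComponentIn_subset _ _) hcomp.isClosed)
      · obtain ⟨b, hbB, hbK⟩ := hB.2
        exact (connectedComponentIn_subset _ _ (h hbK)).2 hbB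
    · rw [connectedComponentIn_eq_empty hxB]
      exact isNowhereDense_empty
  refine not_isMeagre_of_isOpen isOpen_interior (nonempty_iff_ne_empty.2 hne)
    (hmeagre.mono fun z hz => ?_)
  obtain ⟨L, ⟨hL, hLn, hxL⟩, hzL⟩ := hKx (interior_subset hz)
  have hLK : (interior K \ L).Nonempty := by
    by_contra h
    rw [not_nonempty_iff_eq_empty, sdiff_eq_empty] at h
    have := interior_maximal h isOpen_interior
    rw [hL.1.isClosed.isNowhereDense_iff.1 hLn] at this
    exact hne (subset_empty_iff.1 this)
  obtain ⟨b, hb⟩ := hLK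
  obtain ⟨B, hB, hbB, hBsub⟩ := (TopologicalSpace.isBasis_countableBasis X).exists_subset_of_mem_open
    hb (isOpen_interior.sdiff hL.1.isClosed)
  have hBJ : B ∈ J := ⟨hB, b, hbB, interior_subset hb.1⟩
  refine mem_biUnion hBJ ?_
  have hLKB : L ∩ K ⊆ K \ B := fun w hw => ⟨hw.2, fun hwB => (hBsub hwB).2 hw.1⟩
  exact (hX L K hL hK.1).subset_connectedComponentIn ⟨hxL, hx⟩ hLKB ⟨hzL, interior_subset hz⟩

/-- A point `p ∈ K` off the closed composant has a closed neighbourhood `C` off it. Bumping in `K`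
from `x` to `C` yields a continuum missing `p`, hence nowhere dense, that carries the composant into
`C`. -/
theorem IsIndecomposableSubcontinuum.isNowhereDense_of_isClosed_meagerComposant [T3Space X]
    [CompactSpace X] [ConnectedSpace X] [Nontrivial X] [SecondCountableTopology X]
    (hX : HereditarilyUnicoherent X) {K : Set X} (hK : IsIndecomposableSubcontinuum K) {x : X}
    (hx : x ∈ K) (hcl : IsClosed (meagerComposant x)) : IsNowhereDense K := by
  refine hK.isNowhereDense_of_subset_meagerComposant hX hx fun p hpK => ?_
  by_contra hp
  obtain ⟨C, hCp, hC, hCM⟩ := exists_mem_nhds_isClosed_subset (hcl.isOpen_compl.mem_nhds hp)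
  obtain ⟨T, hT, hTK, hxT, ⟨t, htT, htC⟩, hTcl⟩ := hK.1.exists_subcontinuum_inter_nonempty hC
    ⟨p, hpK, mem_of_mem_nhds hCp⟩ hx (fun h => hCM h (mem_meagerComposant_self x))
  have hpT : p ∉ T := by
    intro h
    obtain ⟨w, hw, hw'⟩ := mem_closure_iff_nhds.1 (hTcl h) C hCp
    exact hw'.2 hw
  have hTn := hK.isNowhereDense_of_ssubset hT ⟨hTK, fun h => hpT (h hpK)⟩
  exact hCM htC ⟨T, ⟨hT, hTn, hxT⟩, htT⟩

/-! ### Closedness of meager composants -/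

/-- If every indecomposable subcontinuum is nowhere dense, then meager composants are closed. -/
theorem HereditarilyUnicoherent.isClosed_meagerComposant [T2Space X] [CompactSpace X]
    [ConnectedSpace X] [Nontrivial X] (hX : HereditarilyUnicoherent X)
    (h : ∀ K : Set X, IsIndecomposableSubcontinuum K → IsNowhereDense K) (x : X) :
    IsClosed (meagerComposant x) := by
  refine isClosed_of_closure_subset fun y hy => ?_
  by_contra hyM
  set M := meagerComposant x with hM
  have hxM : x ∈ M := mem_meagerComposant_self x
  obtain ⟨I, hI, hxyI, hImin⟩ := hX.exists_least_subcontinuum (A := {x, y}) ⟨x, by simp⟩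
  have hxI : x ∈ I := hxyI (by simp)
  have hyI : y ∈ I := hxyI (by simp)
  set W := interior I with hWdef
  have hW : W.Nonempty := by
    rw [nonempty_iff_ne_empty]
    intro h0
    exact hyM ⟨I, ⟨hI, hI.1.isClosed.isNowhereDense_iff.2 h0, hxI⟩, hyI⟩
  have hWM : W ⊆ closure M := interior_subset.trans
    (hImin _ (isSubcontinuum_closure_meagerComposant x)
      (by rintro _ (rfl | rfl); exacts [subset_closure hxM, hy]))
  have hWE : ∀ E, IsSubcontinuum E → y ∈ E → (E ∩ M).Nonempty → W ⊆ E := by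
    rintro E hE hyE ⟨m, hmE, L, ⟨hL, hLn, hxL⟩, hmL⟩
    have hIE : I ⊆ E ∪ L := hImin _ (hE.union hL ⟨m, hmE, hmL⟩)
      (by rintro _ (rfl | rfl); exacts [Or.inr hxL, Or.inl hyE])
    have hsub : W \ E ⊆ interior L := interior_maximal
      (fun w hw => (hIE (interior_subset hw.1)).resolve_left hw.2)
      (isOpen_interior.sdiff hE.1.isClosed)
    rw [hL.1.isClosed.isNowhereDense_iff.1 hLn, subset_empty_iff, sdiff_eq_empty] at hsub
    exact hsub
  obtain ⟨C, hC, hWC, hCmin⟩ := hX.exists_least_subcontinuum hW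
  have hWint : W ⊆ interior C := interior_maximal hWC isOpen_interior
  -- If `y ∉ C`, join `y` to a point `z` of `C` by a continuum `T` that misses the interior of `C`,
  -- hence `W`. Adding `T` to a continuum through `z` reaches `y` without helping to cover `W`.
  obtain ⟨z, hzC, hzE⟩ : ∃ z ∈ C, ∀ E, IsSubcontinuum E → z ∈ E → (E ∩ M).Nonempty → W ⊆ E := by
    by_cases hyC : y ∈ C
    · exact ⟨y, hyC, hWE⟩
    obtain ⟨T, hT, -, hyT, ⟨z, hzT, hzC⟩, hTcl⟩ :=
      IsSubcontinuum.exists_subcontinuum_inter_nonempty (K := univ)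
        ⟨isCompact_univ, isConnected_univ⟩ hC.1.isClosed
        (hC.2.nonempty.mono fun c hc => ⟨mem_univ c, hc⟩) (mem_univ y) hyC
    refine ⟨z, hzC, fun E hE hzE hEM w hw => ?_⟩
    have hWET := hWE (E ∪ T) (hE.union hT ⟨z, hzE, hzT⟩) (Or.inr hyT)
      (hEM.mono (inter_subset_inter_left _ subset_union_left))
    refine (hWET hw).resolve_right fun hwT => ?_
    obtain ⟨v, hv, hv'⟩ := mem_closure_iff.1 (hTcl hwT) _ isOpen_interior (hWint hw)
    exact hv'.2 (interior_subset hv)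
  have hCE : ∀ E, IsSubcontinuum E → z ∈ E → (E ∩ M).Nonempty → C ⊆ E :=
    fun E hE hz hEM => hCmin E hE (hzE E hE hz hEM)
  obtain ⟨w, hw⟩ := hW
  obtain ⟨x', hx'W, hx'M⟩ := mem_closure_iff.1 (hWM hw) W isOpen_interior hw
  have hMx' : M ⊆ meagerComposant x' := meagerComposant_subset hx'M
  have hx'sub : meagerComposant x' ⊆ M := meagerComposant_subset (mem_meagerComposant_symm hx'M)
  have hconn : IsPreconnected (M ∩ C) := by
    refine isPreconnected_of_forall x' fun m hm => ?_
    obtain ⟨L, hL, hmL⟩ := hMx' hm.1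
    exact ⟨L ∩ C, inter_subset_inter_left _ fun l hl => hx'sub ⟨L, hL, hl⟩,
      ⟨hL.2.2, hWC hx'W⟩, ⟨hmL, hm.2⟩, hX L C hL.1 hC⟩
  -- Minimality of `C`: this closure is a continuum, and it contains `W` because `M` is dense in
  -- `W`.
  have hdense : C ⊆ closure (M ∩ C) := by
    refine hCmin _ ⟨isClosed_closure.isCompact,
      IsConnected.closure ⟨⟨x', hx'M, hWC hx'W⟩, hconn⟩⟩ fun v hv => ?_
    rw [mem_closure_iff]
    intro O hO hvO
    obtain ⟨m, ⟨hmO, hmW⟩, hmM⟩ :=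
      mem_closure_iff.1 (hWM hv) (O ∩ W) (hO.inter isOpen_interior) ⟨hvO, hv⟩
    exact ⟨m, hmO, hmM, hWC hmW⟩
  have hside : ∀ A B : Set X, IsSubcontinuum A → IsSubcontinuum B → A ⊂ C → B ⊂ C →
      A ∪ B = C → z ∉ A := by
    intro A B hA hB hAC hBC hAB hzA
    obtain ⟨c, hcC, hcB⟩ := exists_of_ssubset hBC
    -- Density puts a point of `M` in `C \ B`, so `A` meets `M` and must contain `C`.
    obtain ⟨m, hmB, hmM, hmC⟩ := mem_closure_iff.1 (hdense hcC) _ hB.1.isClosed.isOpen_compl hcB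
    have hmA : m ∈ A := (hAB ▸ hmC : m ∈ A ∪ B).resolve_right hmB
    exact hAC.2 (hCE A hA hzA ⟨m, hmA, hmM⟩)
  have hind : IsIndecomposableSubcontinuum C := by
    refine ⟨hC, ?_⟩
    rintro ⟨A, B, hA, hB, hAC, hBC, hAB⟩
    rcases (hAB ▸ hzC : z ∈ A ∪ B) with hz | hz
    · exact hside A B hA hB hAC hBC hAB hz
    · exact hside B A hB hA hBC hAC (union_comm A B ▸ hAB) hz
  have hCint := hWint hw
  rw [hC.1.isClosed.isNowhereDense_iff.1 (h C hind)] at hCint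
  exact hCint

end General

theorem theorem9 {X : Type*} [MetricSpace X] [CompactSpace X] [ConnectedSpace X] [Nontrivial X]
    (hX : HereditarilyUnicoherent X) :
    (∀ M : Set X, IsMeagerComposant M → IsClosed M) ↔
      (∀ K : Set X, IsIndecomposableSubcontinuum K → IsNowhereDense K) := by
  constructor
  · intro h K hK
    obtain ⟨x, hx⟩ := hK.1.2.nonempty
    exact hK.isNowhereDense_of_isClosed_meagerComposant hX hx (h _ ⟨x, rfl⟩)
  · rintro h _ ⟨x, rfl⟩
    exact hX.isClosed_meagerComposant h x
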